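/- A matrix Lie group is a closed subgroup $G$ of $\mathrm{GL}_d(\mathbb{R})$ (for some $d$); its Lie algebra is $\mathcal{L}(G)=\{X\in \mathrm{M}_d(\mathbb{R}) : \exp(tX)\in G \text{ for all } t\in\mathbb{R}\}$, with the bracket $[X,Y]=XY-YX$. A map $f:G_1\to G_2$ between matrix Lie groups is smooth if it is continuous and, for every $g\in G_1$, the matrix-valued map $X\mapsto f(g\exp(X))$ on the real vector space $\mathcal{L}(G_1)$ is $C^\infty$ (that is, $f$ is $C^\infty$ in the exponential charts of $G_1$). **Theorem.** Let $G_1\subseteq \mathrm{GL}_{d_1}(\mathbb{R})$ and $G_2\subseteq \mathrm{GL}_{d_2}(\mathbb{R})$ be matrix Lie groups, and suppose that $G_1$ is simply connected, i.e. path connected and such that any two paths in $G_1$ with the same endpoints are homotopic relative to the endpoints. Let $F:\mathcal{L}(G_1)\to\mathcal{L}(G_2)$ be a homomorphism of real Lie algebras, i.e. a linear map that preserves brackets. Then there exists a smooth group homomorphism $f:G_1\to G_2$ with $Df=F$, that is, such that $$\exp(F(X))=f(\exp(X))\quad\text{for all } X\in\mathcal{L}(G_1).$$ -/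

import Mathlib

attribute [local instance 100] LieRing.ofAssociativeRing

namespace MatrixLie

section NormedAlgebra

open NormedSpace Filter Topology
variable {A : Type*} [NormedRing A]

theorem norm_pow_sub_pow_le (h1 : ‖(1 : A)‖ ≤ 1) {a b : A} {M : ℝ} (ha : ‖a‖ ≤ M) (hb : ‖b‖ ≤ M)
    (hM : 1 ≤ M) (n : ℕ) : ‖a ^ n - b ^ n‖ ≤ n * M ^ n * ‖a - b‖ := by
  have hM0 : 0 ≤ M := by linarith
  have hbp : ∀ k : ℕ, ‖b ^ k‖ ≤ M ^ k := by
    intro k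
    induction k with
    | zero => simpa using h1
    | succ k ih =>
      rw [pow_succ, pow_succ]
      exact (norm_mul_le _ _).trans (mul_le_mul ih hb (norm_nonneg _) (by positivity))
  induction n with
  | zero => simp
  | succ n ih =>
    have e : a ^ (n + 1) - b ^ (n + 1) = a * (a ^ n - b ^ n) + (a - b) * b ^ n := by
      rw [pow_succ', pow_succ']; noncomm_ring
    rw [e]
    have h2 : ‖a * (a ^ n - b ^ n)‖ ≤ M * (n * M ^ n * ‖a - b‖) :=
      (norm_mul_le _ _).trans (mul_le_mul ha ih (norm_nonneg _) hM0)
    have h3 : ‖(a - b) * b ^ n‖ ≤ M ^ (n + 1) * ‖a - b‖ := by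
      refine (norm_mul_le _ _).trans ?_
      rw [mul_comm]
      refine mul_le_mul_of_nonneg_right ((hbp n).trans ?_) (norm_nonneg _)
      exact pow_le_pow_right₀ hM (Nat.le_succ n)
    refine (norm_add_le _ _).trans ((add_le_add h2 h3).trans (le_of_eq ?_))
    push_cast
    ring

variable [NormedAlgebra ℝ A]

theorem eventually_norm_le_of_hasDerivAt (h1 : ‖(1 : A)‖ ≤ 1) {γ : ℝ → A} {X : A} (h0 : γ 0 = 1)
    (hγ : HasDerivAt γ X 0) : ∀ᶠ t in 𝓝 (0 : ℝ), ‖γ t‖ ≤ 1 + (‖X‖ + 1) * |t| := by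
  have h := (hasDerivAt_iff_isLittleO.1 hγ).bound (zero_lt_one)
  filter_upwards [h] with t ht
  rw [h0] at ht
  simp only [sub_zero, one_mul, Real.norm_eq_abs] at ht
  have e : γ t = (γ t - 1 - t • X) + 1 + t • X := by abel
  have h2 : ‖t • X‖ = |t| * ‖X‖ := by rw [norm_smul, Real.norm_eq_abs]
  calc ‖γ t‖ = ‖(γ t - 1 - t • X) + 1 + t • X‖ := by rw [← e]
    _ ≤ ‖γ t - 1 - t • X‖ + ‖(1 : A)‖ + ‖t • X‖ := norm_add₃_le
    _ ≤ |t| + 1 + |t| * ‖X‖ := by rw [h2]; gcongr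
    _ = 1 + (‖X‖ + 1) * |t| := by ring

theorem tendsto_pow_exp [CompleteSpace A] (h1 : ‖(1 : A)‖ ≤ 1) {γ : ℝ → A} {X : A} (h0 : γ 0 = 1)
    (hγ : HasDerivAt γ X 0) (s : ℝ) :
    Tendsto (fun n : ℕ => γ (s / n) ^ n) atTop (𝓝 (exp (s • X))) := by
  let _ : NormedAlgebra ℚ A := NormedAlgebra.restrictScalars ℚ ℝ A
  set b : ℝ → A := fun t => exp (t • X) with hbdef
  have hb0 : b 0 = 1 := by simp [hbdef]
  have hb : HasDerivAt b X 0 := by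
    have := hasDerivAt_exp_smul_const (𝕂 := ℝ) X 0
    simpa [hbdef] using this
  have hs : Tendsto (fun n : ℕ => s / n) atTop (𝓝 0) := tendsto_const_div_atTop_nhds_zero_nat s
  set K := ‖X‖ + 1
  have hK : 0 ≤ K := by positivity
  have hpow : ∀ᶠ n : ℕ in atTop, exp (s • X) = b (s / n) ^ n := by
    filter_upwards [eventually_gt_atTop 0] with n hn
    have hn' : (n : ℝ) ≠ 0 := by positivity
    simp only [hbdef]
    rw [← exp_nsmul, ← Nat.cast_smul_eq_nsmul ℝ, smul_smul]
    congr 2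
    field_simp
  have hdiff : HasDerivAt (fun t => γ t - b t) 0 0 := by
    have h := hγ.sub hb
    rw [sub_self] at h
    exact h
  have hlo : Tendsto (fun n : ℕ => (n : ℝ) * ‖γ (s / n) - b (s / n)‖) atTop (𝓝 0) := by
    have h := hasDerivAt_iff_isLittleO.1 hdiff
    simp only [h0, hb0, sub_self, sub_zero, smul_zero] at h
    have h2 := h.comp_tendsto hs
    rw [Metric.tendsto_atTop]
    intro ε hε
    have h3 := h2.bound (c := ε / (|s| + 1)) (by positivity)
    obtain ⟨N, hN⟩ := eventually_atTop.1 (h3.and (eventually_gt_atTop 0))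
    refine ⟨N, fun n hn => ?_⟩
    obtain ⟨h4, hn0⟩ := hN n hn
    have hn' : (0 : ℝ) < n := by exact_mod_cast hn0
    simp only [Function.comp_apply, Real.norm_eq_abs, abs_div, Nat.abs_cast] at h4
    rw [dist_zero_right, Real.norm_eq_abs, abs_of_nonneg (by positivity)]
    calc (n : ℝ) * ‖γ (s / n) - b (s / n)‖ ≤ n * (ε / (|s| + 1) * (|s| / n)) := by gcongr
      _ = ε * (|s| / (|s| + 1)) := by field_simp
      _ < ε * 1 := by
        gcongr
        rw [div_lt_one (by positivity)]
        linarith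
      _ = ε := mul_one _
  have hM := hs.eventually ((eventually_norm_le_of_hasDerivAt h1 h0 hγ).and
    (eventually_norm_le_of_hasDerivAt h1 hb0 hb))
  rw [tendsto_iff_norm_sub_tendsto_zero]
  refine squeeze_zero' (Eventually.of_forall fun _ => norm_nonneg _)
    (g := fun n : ℕ => Real.exp (K * |s|) * ((n : ℝ) * ‖γ (s / n) - b (s / n)‖)) ?_ ?_
  · filter_upwards [hM, hpow, eventually_gt_atTop 0] with n hn hp hn0
    have hn' : (0 : ℝ) < n := by exact_mod_cast hn0
    rw [hp]
    have hle := norm_pow_sub_pow_le h1 hn.1 hn.2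
      (by have : 0 ≤ K * |s / (n : ℝ)| := by positivity
          linarith) n
    have hexp : (1 + K * |s / (n : ℝ)|) ^ n ≤ Real.exp (K * |s|) := by
      have h5 : 1 + K * |s / (n : ℝ)| ≤ Real.exp (K * |s / (n : ℝ)|) := by
        rw [add_comm]; exact Real.add_one_le_exp _
      refine (pow_le_pow_left₀ (by positivity) h5 n).trans (le_of_eq ?_)
      rw [← Real.exp_nat_mul]
      congr 1
      rw [abs_div, Nat.abs_cast]
      field_simp
    calc _ ≤ _ := hle
      _ ≤ n * Real.exp (K * |s|) * ‖γ (s / n) - b (s / n)‖ := by gcongr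
      _ = _ := by ring
  · simpa using hlo.const_mul (Real.exp (K * |s|))

variable [CompleteSpace A]

theorem exp_mul_exp_neg (X : A) : exp X * exp (-X) = 1 := by
  let _ : NormedAlgebra ℚ A := NormedAlgebra.restrictScalars ℚ ℝ A
  rw [← exp_add_of_commute (Commute.neg_right (Commute.refl X)), add_neg_cancel, exp_zero]

noncomputable def expUnit (X : A) : Aˣ where
  val := exp X
  inv := exp (-X)
  val_inv := exp_mul_exp_neg X
  inv_val := by simpa using exp_mul_exp_neg (-X)

theorem continuous_expUnit : Continuous (expUnit : A → Aˣ) := by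
  let _ : NormedAlgebra ℚ A := NormedAlgebra.restrictScalars ℚ ℝ A
  exact Units.continuous_iff.2 ⟨exp_continuous, exp_continuous.comp continuous_neg⟩

theorem hasDerivAt_exp_smul (X : A) : HasDerivAt (fun t : ℝ => exp (t • X)) X 0 := by
  have := hasDerivAt_exp_smul_const (𝕂 := ℝ) X 0
  simpa using this

variable {G : Subgroup Aˣ}

/-- The velocity at the identity of a curve in `G` generates a one-parameter subgroup of `G`. -/
theorem expUnit_smul_mem_of_hasDerivAt (h1 : ‖(1 : A)‖ ≤ 1) (hcl : IsClosed (G : Set Aˣ))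
    {γ : ℝ → Aˣ} {X : A} (hG : ∀ t, γ t ∈ G) (h0 : γ 0 = 1)
    (hγ : HasDerivAt (fun t => (γ t : A)) X 0) (s : ℝ) : expUnit (s • X) ∈ G := by
  have h := tendsto_pow_exp h1 (by simp [h0]) hγ s
  refine hcl.mem_of_tendsto (f := fun n : ℕ => γ (s / n) ^ n) (b := atTop) ?_
    (Eventually.of_forall fun n => pow_mem (hG _) n)
  rw [Units.isOpenEmbedding_val.isInducing.tendsto_nhds_iff]
  refine h.congr fun n => ?_
  simp

theorem expUnit_smul_add_mem (h1 : ‖(1 : A)‖ ≤ 1) (hcl : IsClosed (G : Set Aˣ)) {X Y : A}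
    (hX : ∀ t : ℝ, expUnit (t • X) ∈ G) (hY : ∀ t : ℝ, expUnit (t • Y) ∈ G) (t : ℝ) :
    expUnit (t • (X + Y)) ∈ G := by
  refine expUnit_smul_mem_of_hasDerivAt h1 hcl (γ := fun t => expUnit (t • X) * expUnit (t • Y))
    (fun t => mul_mem (hX t) (hY t)) (by ext; simp [expUnit]) ?_ t
  have h := (hasDerivAt_exp_smul X).mul (hasDerivAt_exp_smul Y)
  simp only [zero_smul, exp_zero, one_mul, mul_one] at h
  exact h

theorem expUnit_smul_bracket_mem (h1 : ‖(1 : A)‖ ≤ 1) (hcl : IsClosed (G : Set Aˣ)) {X Y : A}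
    (hX : ∀ t : ℝ, expUnit (t • X) ∈ G) (hY : ∀ t : ℝ, expUnit (t • Y) ∈ G) (t : ℝ) :
    expUnit (t • (X * Y - Y * X)) ∈ G := by
  let _ : NormedAlgebra ℚ A := NormedAlgebra.restrictScalars ℚ ℝ A
  have hsmul : ∀ {Z : A}, (∀ t : ℝ, expUnit (t • Z) ∈ G) → ∀ c t : ℝ,
      expUnit (t • c • Z) ∈ G := fun hZ c t => by rw [smul_smul]; exact hZ _
  have hconj : ∀ r t : ℝ, expUnit (t • (exp (r • X) * Y * exp (-(r • X)))) ∈ G := by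
    intro r t
    have e : expUnit (t • (exp (r • X) * Y * exp (-(r • X)))) =
        expUnit (r • X) * expUnit (t • Y) * (expUnit (r • X))⁻¹ := by
      ext
      rw [← smul_mul_assoc, ← mul_smul_comm]
      exact exp_units_conj (expUnit (r • X)) (t • Y)
    rw [e]
    exact mul_mem (mul_mem (hX r) (hY t)) (inv_mem (hX r))
  have hder : HasDerivAt (fun r : ℝ => exp (r • X) * Y * exp (-(r • X))) (X * Y - Y * X) 0 := by
    have h := ((hasDerivAt_exp_smul X).mul_const Y).mul (hasDerivAt_exp_smul (-X))
    simp only [zero_smul, exp_zero, one_mul, mul_one, smul_neg, mul_neg, neg_zero,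
      ← sub_eq_add_neg] at h
    exact h
  have hlim := hasDerivAt_iff_tendsto_slope.1 hder
  have hclosed : IsClosed {Z : A | expUnit (t • Z) ∈ G} :=
    hcl.preimage (continuous_expUnit.comp (continuous_const_smul t))
  refine hclosed.mem_of_tendsto hlim (Eventually.of_forall fun r => ?_)
  have h2 : slope (fun r : ℝ => exp (r • X) * Y * exp (-(r • X))) 0 r =
      (r - 0)⁻¹ • (exp (r • X) * Y * exp (-(r • X)) + (-1 : ℝ) • Y) := by
    simp [slope_def_module, sub_eq_add_neg]
  change expUnit (t • slope _ 0 r) ∈ G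
  rw [h2]
  exact hsmul (expUnit_smul_add_mem h1 hcl (hconj r) (hsmul hY (-1))) _ t

end NormedAlgebra

section Matrix

open NormedSpace

open scoped ContDiff

variable {d : ℕ}

theorem norm_one_le : letI := Matrix.linftyOpNormedRing (n := Fin d) (α := ℝ)
    ‖(1 : Matrix (Fin d) (Fin d) ℝ)‖ ≤ 1 := by
  let _ := Matrix.linftyOpNormedRing (n := Fin d) (α := ℝ)
  rcases isEmpty_or_nonempty (Fin d) with h | h
  · rw [Subsingleton.elim (1 : Matrix (Fin d) (Fin d) ℝ) 0, norm_zero]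
    exact zero_le_one
  · let _ := Matrix.linfty_opNormOneClass (n := Fin d) (α := ℝ)
    exact norm_one.le

theorem completeSpace :
    @CompleteSpace (Matrix (Fin d) (Fin d) ℝ)
      Matrix.linftyOpNormedRing.toPseudoMetricSpace.toUniformSpace :=
  inferInstanceAs (CompleteSpace (Fin d → Fin d → ℝ))

/-- The matrix exponential `∑ Xⁿ / n!`, as an element of `GL_d(ℝ)`. -/
noncomputable def expGL (X : Matrix (Fin d) (Fin d) ℝ) : GL (Fin d) ℝ where
  val := exp X
  inv := exp (-X)
  val_inv := by
    rw [← Matrix.exp_add_of_commute _ _ (Commute.neg_right (Commute.refl X)), add_neg_cancel,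
      exp_zero]
  inv_val := by
    rw [← Matrix.exp_add_of_commute _ _ (Commute.neg_left (Commute.refl X)), neg_add_cancel,
      exp_zero]

/-- A matrix Lie group: a closed subgroup of `GL_d(ℝ)`. -/
abbrev MatrixLieGroup (d : ℕ) : Type := ClosedSubgroup (GL (Fin d) ℝ)

/-- The Lie algebra `{X ∈ M_d(ℝ) : exp(tX) ∈ G for all t ∈ ℝ}` of a matrix Lie group `G`, with the
bracket `[X, Y] = XY - YX`. -/
noncomputable def lieAlgebra (G : MatrixLieGroup d) :
    LieSubalgebra ℝ (Matrix (Fin d) (Fin d) ℝ) where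
  carrier := {X | ∀ t : ℝ, expGL (t • X) ∈ G}
  zero_mem' := fun t => by
    have h : expGL (t • (0 : Matrix (Fin d) (Fin d) ℝ)) = 1 := by
      ext1
      simp [expGL]
    rw [h]
    exact one_mem G
  smul_mem' := fun c X hX t => by
    rw [smul_smul]
    exact hX (t * c)
  add_mem' := fun {X Y} hX hY t =>
    @expUnit_smul_add_mem _ Matrix.linftyOpNormedRing Matrix.linftyOpNormedAlgebra completeSpace
      G.toSubgroup norm_one_le G.isClosed' X Y hX hY t
  lie_mem' := fun {X Y} hX hY t =>
    @expUnit_smul_bracket_mem _ Matrix.linftyOpNormedRing Matrix.linftyOpNormedAlgebra completeSpace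
      G.toSubgroup norm_one_le G.isClosed' X Y hX hY t

/-- The exponential map `L(G) → G`. -/
noncomputable def lieExp (G : MatrixLieGroup d) (X : lieAlgebra G) : G :=
  ⟨expGL X, by simpa using X.2 1⟩

variable {d₁ d₂ : ℕ} {G₁ : MatrixLieGroup d₁} {G₂ : MatrixLieGroup d₂}

section Smooth

attribute [local instance] Matrix.frobeniusNormedAddCommGroup Matrix.frobeniusNormedSpace

/-- Smoothness of a map `f : G₁ → G₂` of matrix Lie groups: `f` is continuous and, for every
`g ∈ G₁`, the matrix-valued map `X ↦ f (g * exp X)` on the vector space `L(G₁)` is `C^∞`.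
The coordinate charts of `G₁` around `g` are the restrictions of `X ↦ g * exp X` to the small
neighbourhoods of `0`; as `exp` is smooth, smoothness in all these charts amounts to smoothness of
`X ↦ f (g * exp X)` on all of `L(G₁)` for every `g`. -/
def IsSmooth (f : G₁ → G₂) : Prop :=
  Continuous f ∧ ∀ g : G₁, ContDiff ℝ ∞ fun X : lieAlgebra G₁ =>
    ((f (g * lieExp G₁ X) : GL (Fin d₂) ℝ) : Matrix (Fin d₂) (Fin d₂) ℝ)

end Smooth

/-- `Df = F`: the Lie algebra homomorphism `F : L(G₁) → L(G₂)` is the differential of the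
group homomorphism `f : G₁ → G₂`, that is, `exp (F X) = f (exp X)` for all `X ∈ L(G₁)`. (Replacing
`X` by `t X`, one sees that at most one linear map `F` has this property.) -/
def IsDifferential (f : G₁ →* G₂) (F : lieAlgebra G₁ →ₗ⁅ℝ⁆ lieAlgebra G₂) : Prop :=
  ∀ X : lieAlgebra G₁, lieExp G₂ (F X) = f (lieExp G₁ X)

end Matrix

end MatrixLie

/-! Near `1` the group is parametrised by its Lie algebra, so `φ g = exp (F (log g))` is the only
candidate there. That `φ` is multiplicative near `1` is proved by a differential equation, without
the Baker-Campbell-Hausdorff series. Along `Z t = log (x * exp (t • Y))` one has `∫₀¹ exp (-sZ) Z'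
exp (sZ) ds = Y`. As `F` preserves brackets it commutes with these conjugations, so the same
identity holds for `F ∘ Z` and `F Y`, and `exp (F (Z t)) * exp (-(t • F Y))` is constant
(`exp_map_eq_mul_of_curve`).

A local homomorphism on a simply connected, locally path connected group extends globally, because
the covering that it defines has a section (`exists_monoidHom_eventuallyEq`). The closed subgroup
theorem (`eventually_exists_expUnit_eq`) provides local path connectedness, places `log g` in the
Lie algebra, and shows that exponentials generate `G₁`, so that the image lies in `G₂`. Smoothness
follows from `f (g * exp X) = f g * exp (F X)`. -/

namespace MatrixLie

open NormedSpace Filter Topology Set MeasureTheory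

/-! ### Extension of local homomorphisms by covering spaces -/

section LocalHom

variable {G H : Type*} [Group G] [TopologicalSpace G] [IsTopologicalGroup G] [Group H]

/-- The covering of `G` with fibre `H` whose continuous sections are the maps `f : G → H` that
satisfy `f (g * v) = f g * φ v` for small `v`. -/
def localHomBundleCore [TopologicalSpace H] [DiscreteTopology H] (φ : G → H) (V : Set G)
    (hVo : IsOpen V) (h1 : (1 : G) ∈ V)
    (hφ : ∀ x ∈ V, ∀ y ∈ V, φ x = φ (x * y⁻¹) * φ y) : FiberBundleCore G G H where
  baseSet g := {x | g⁻¹ * x ∈ V}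
  isOpen_baseSet g := hVo.preimage (continuous_const_mul g⁻¹)
  indexAt x := x
  mem_baseSet_at x := by simpa using h1
  coordChange g h x c := c * φ (g⁻¹ * x) * (φ (h⁻¹ * x))⁻¹
  coordChange_self := by simp
  continuousOn_coordChange g h := by
    -- On the overlap `hφ` gives `φ (g⁻¹ * x) * (φ (h⁻¹ * x))⁻¹ = φ (g⁻¹ * h)`, which does not
    -- depend on `x`; hence the transition maps are continuous.
    have hc : Continuous fun p : G × H => p.2 * φ (g⁻¹ * h) :=
      (continuous_of_discreteTopology (f := fun c : H => c * φ (g⁻¹ * h))).comp continuous_snd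
    refine hc.continuousOn.congr ?_
    rintro ⟨x, c⟩ ⟨⟨hx, hx'⟩, -⟩
    have e := hφ _ hx _ hx'
    have e' : g⁻¹ * x * (h⁻¹ * x)⁻¹ = g⁻¹ * h := by group
    rw [e'] at e
    simp [e, mul_assoc]
  coordChange_comp := by simp [mul_assoc]

theorem apply_eq_of_forall_eventually_eq {X Y : Type*} [TopologicalSpace X]
    [PreconnectedSpace X] {k : X → Y} (hk : ∀ x, ∀ᶠ y in 𝓝 x, k y = k x) (x y : X) : k x = k y :=
  IsLocallyConstant.apply_eq_of_preconnectedSpace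
    ((IsLocallyConstant.iff_eventually_eq k).2 hk) x y

/-- A local homomorphism from a simply connected group extends to a homomorphism. -/
theorem exists_monoidHom_eventuallyEq [SimplyConnectedSpace G] [LocallyPathConnectedSpace G]
    {φ : G → H} {U : Set G} (hU : U ∈ 𝓝 1) (hφ : ∀ x ∈ U, ∀ y ∈ U, φ (x * y) = φ x * φ y) :
    ∃ f : G →* H, ∀ᶠ x in 𝓝 1, f x = φ x := by
  -- Any topology on `H` is irrelevant here: with discrete fibres the bundle is a covering, and the
  -- identity of `G` lifts to a section.
  let _ : TopologicalSpace H := ⊥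
  have _ : DiscreteTopology H := ⟨rfl⟩
  have h11 : φ 1 = 1 := by simpa using hφ 1 (mem_of_mem_nhds hU) 1 (mem_of_mem_nhds hU)
  obtain ⟨V, hVo, h1, hVU⟩ : ∃ V : Set G, IsOpen V ∧ 1 ∈ V ∧ ∀ x ∈ V, ∀ y ∈ V,
      x * y⁻¹ ∈ U ∧ y ∈ U := by
    have hc : Tendsto (fun p : G × G => p.1 * p.2⁻¹) (𝓝 1 ×ˢ 𝓝 1) (𝓝 1) := by
      have h : Continuous fun p : G × G => p.1 * p.2⁻¹ := by fun_prop
      have := h.tendsto (1, 1)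
      rwa [nhds_prod_eq, inv_one, mul_one] at this
    have hs : Tendsto (fun p : G × G => p.2) (𝓝 1 ×ˢ 𝓝 1) (𝓝 1) := tendsto_snd
    have h : ∀ᶠ p : G × G in 𝓝 1 ×ˢ 𝓝 1, p.1 * p.2⁻¹ ∈ U ∧ p.2 ∈ U :=
      (hc.eventually hU).and (hs.eventually hU)
    obtain ⟨W, hW, hWU⟩ := (eventually_prod_self_iff (r := fun x y => x * y⁻¹ ∈ U ∧ y ∈ U)).1 h
    obtain ⟨V, hVW, hVo, h1⟩ := mem_nhds_iff.1 hW
    exact ⟨V, hVo, h1, fun x hx y hy => hWU x (hVW hx) y (hVW hy)⟩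
  have hV : ∀ x ∈ V, ∀ y ∈ V, φ x = φ (x * y⁻¹) * φ y := fun x hx y hy => by
    obtain ⟨h, h'⟩ := hVU x hx y hy
    rw [← hφ _ h _ h', inv_mul_cancel_right]
  let Z := localHomBundleCore φ V hVo h1 hV
  have hcov : IsCoveringMap (Bundle.TotalSpace.proj : Z.TotalSpace → G) :=
    FiberBundle.isCoveringMap
  obtain ⟨s, ⟨hs1, hs⟩, -⟩ := hcov.existsUnique_continuousMap_lifts (ContinuousMap.id G) 1
    (⟨1, (1 : H)⟩ : Z.TotalSpace) rfl
  let f : G → H := fun x => (s x).2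
  have hf1 : f 1 = 1 := by
    change (s 1).2 = (1 : H)
    rw [hs1]
  have hsx : ∀ x, (s x).1 = x := fun x => congrFun hs x
  have hf : ∀ g, ∀ᶠ v in 𝓝 1, f (g * v) = f g * φ v := by
    intro g
    have hc : ContinuousAt (fun x => ((Z.localTriv g) (s x)).2) g := by
      refine continuous_snd.continuousAt.comp (ContinuousAt.comp ?_ s.continuous.continuousAt)
      refine (Z.localTriv g).continuousAt ?_
      rw [Z.mem_localTriv_source, hsx]
      exact Z.mem_baseSet_at g
    -- The number `f x` is the fibre coordinate in the chart centred at `x` itself; in the chart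
    -- centred at `g` it becomes this product, which is continuous at `g` into a discrete space, so
    -- constant near `g`.
    have hc' : (fun x => ((Z.localTriv g) (s x)).2) = fun x => f x * (φ (g⁻¹ * x))⁻¹ := by
      funext x
      rw [Z.localTriv_apply]
      change f x * φ ((s x).1⁻¹ * (s x).1) * (φ (g⁻¹ * (s x).1))⁻¹ = _
      rw [hsx, inv_mul_cancel, h11, mul_one]
    rw [hc'] at hc
    have hc2 : ∀ᶠ x in 𝓝 g, f x * (φ (g⁻¹ * x))⁻¹ ∈ ({f g} : Set H) :=
      hc (IsOpen.mem_nhds (isOpen_discrete _) (by simp [h11]))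
    have ht : Tendsto (fun v => g * v) (𝓝 1) (𝓝 g) := by
      simpa using (continuous_const_mul g).tendsto (1 : G)
    filter_upwards [ht.eventually hc2] with v hv
    simp only [mem_singleton_iff, inv_mul_cancel_left] at hv
    exact mul_inv_eq_iff_eq_mul.1 hv
  have hmul : ∀ a b, f (a * b) = f a * f b := by
    intro a b
    -- Moving from `x` to `y` multiplies `f (a * x)` and `f x` on the right by the same `φ (x⁻¹ *
    -- y)`, which cancels in the quotient.
    have hk : ∀ x, ∀ᶠ y in 𝓝 x, f (a * y) * (f y)⁻¹ = f (a * x) * (f x)⁻¹ := by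
      intro x
      have ht : Tendsto (fun y => x⁻¹ * y) (𝓝 x) (𝓝 1) := by
        simpa using (continuous_const_mul x⁻¹).tendsto x
      filter_upwards [ht.eventually (hf x), ht.eventually (hf (a * x))] with y hy hy'
      rw [mul_assoc, mul_inv_cancel_left] at hy'
      rw [mul_inv_cancel_left] at hy
      rw [hy, hy']
      group
    have := apply_eq_of_forall_eventually_eq hk b 1
    rw [hf1, mul_one, inv_one, mul_one] at this
    rw [← this, inv_mul_cancel_right]
  refine ⟨⟨⟨f, hf1⟩, hmul⟩, ?_⟩
  filter_upwards [hf 1] with v hv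
  simpa [hf1] using hv

end LocalHom

/-! ### The derivative of the exponential and bracket-preserving maps -/

section ExpDerivative

variable {A B : Type*} [NormedRing A] [NormedAlgebra ℝ A] [CompleteSpace A]
  [NormedRing B] [NormedAlgebra ℝ B] [CompleteSpace B]

theorem continuous_exp : Continuous (exp : A → A) := by
  let _ : NormedAlgebra ℚ A := NormedAlgebra.restrictScalars ℚ ℝ A
  exact exp_continuous

theorem hasDerivAt_exp_neg_smul (X : A) (t : ℝ) :
    HasDerivAt (fun s : ℝ => exp (-(s • X))) (-(X * exp (-(t • X)))) t := by
  have h := hasDerivAt_exp_smul_const' (𝕂 := ℝ) (-X) t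
  simpa only [smul_neg, neg_mul] using h

/-- The integrand is the derivative of `exp ((1 - s) • Z) * exp (s • K)`, which runs from `exp Z` to
`exp K`. Being exact, the formula turns difference quotients of `exp` into integrals. -/
theorem exp_sub_exp_eq_integral (Z K : A) :
    exp K - exp Z = ∫ s in (0 : ℝ)..1, exp ((1 - s) • Z) * (K - Z) * exp (s • K) := by
  have hd : ∀ s : ℝ, HasDerivAt (fun s : ℝ => exp ((1 - s) • Z) * exp (s • K))
      (exp ((1 - s) • Z) * (K - Z) * exp (s • K)) s := by
    intro s
    have h1 : HasDerivAt (fun s : ℝ => exp ((1 - s) • Z)) (-(exp ((1 - s) • Z) * Z)) s := by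
      have h := (hasDerivAt_exp_smul_const (𝕂 := ℝ) Z (1 - s)).scomp s
        ((hasDerivAt_id s).const_sub 1)
      simpa [Function.comp_def] using h
    have h2 := h1.mul (hasDerivAt_exp_smul_const' (𝕂 := ℝ) K s)
    refine h2.congr_deriv ?_
    noncomm_ring
  rw [intervalIntegral.integral_eq_sub_of_hasDerivAt (fun s _ => hd s)]
  · simp
  · refine Continuous.intervalIntegrable ?_ _ _
    have := continuous_exp (A := A)
    fun_prop

/-- By `exp_sub_exp_eq_integral` the slope of `exp ∘ Z` is an integral depending jointly
continuously on the slope of `Z` and on its endpoint, so the limit passes inside. -/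
theorem hasDerivAt_exp_comp {Z : ℝ → A} {W : A} {t : ℝ} (hZ : HasDerivAt Z W t) :
    HasDerivAt (fun s => exp (Z s))
      (exp (Z t) * ∫ s in (0 : ℝ)..1, exp (-(s • Z t)) * W * exp (s • Z t)) t := by
  let _ : NormedAlgebra ℚ A := NormedAlgebra.restrictScalars ℚ ℝ A
  have hexp := continuous_exp (A := A)
  have hJ : Continuous fun p : A × A =>
      ∫ s in (0 : ℝ)..1, exp ((1 - s) • Z t) * p.1 * exp (s • p.2) := by
    refine intervalIntegral.continuous_parametric_intervalIntegral_of_continuous' ?_ _ _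
    simp only [Function.uncurry_def]
    fun_prop
  have e : exp (Z t) * (∫ s in (0 : ℝ)..1, exp (-(s • Z t)) * W * exp (s • Z t)) =
      ∫ s in (0 : ℝ)..1, exp ((1 - s) • Z t) * W * exp (s • Z t) := by
    have h := (ContinuousLinearMap.mul ℝ A (exp (Z t))).intervalIntegral_comp_comm (μ := volume)
      (f := fun s : ℝ => exp (-(s • Z t)) * W * exp (s • Z t)) (a := 0) (b := 1)
      (Continuous.intervalIntegrable (by fun_prop) _ _)
    simp only [ContinuousLinearMap.mul_apply'] at h
    rw [← h]
    refine intervalIntegral.integral_congr fun s _ => ?_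
    simp only [← mul_assoc]
    rw [← exp_add_of_commute (((Commute.refl (Z t)).smul_right s).neg_right), sub_smul, one_smul,
      sub_eq_add_neg]
  rw [e, hasDerivAt_iff_tendsto_slope]
  have hs : Tendsto (fun u => (slope Z t u, Z u)) (𝓝[≠] t) (𝓝 (W, Z t)) :=
    (hasDerivAt_iff_tendsto_slope.1 hZ).prodMk_nhds
      (hZ.continuousAt.tendsto.mono_left nhdsWithin_le_nhds)
  refine ((hJ.tendsto (W, Z t)).comp hs).congr fun u => ?_
  rw [slope_def_module, exp_sub_exp_eq_integral, ← intervalIntegral.integral_smul]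
  simp [slope_def_module]

variable {L : Submodule ℝ A} {F : A →L[ℝ] B}

/-- A map that preserves brackets intertwines the adjoint actions of one-parameter groups. -/
theorem map_exp_conj (hLc : ∀ X ∈ L, ∀ Y ∈ L, exp (-X) * Y * exp X ∈ L)
    (hF : ∀ X ∈ L, ∀ Y ∈ L, F (X * Y - Y * X) = F X * F Y - F Y * F X) {Z W : A} (hZ : Z ∈ L)
    (hW : W ∈ L) (s : ℝ) :
    F (exp (-(s • Z)) * W * exp (s • Z)) = exp (-(s • F Z)) * F W * exp (s • F Z) := by
  set c : ℝ → A := fun s => exp (-(s • Z)) * W * exp (s • Z) with hc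
  have hcL : ∀ s, c s ∈ L := fun s => hLc _ (L.smul_mem s hZ) _ hW
  have hcd : ∀ s, HasDerivAt c (c s * Z - Z * c s) s := by
    intro s
    have h := ((hasDerivAt_exp_neg_smul Z s).mul_const W).mul
      (hasDerivAt_exp_smul_const (𝕂 := ℝ) Z s)
    refine h.congr_deriv ?_
    simp only [hc]
    noncomm_ring
  -- Since `c' = [c, Z]`, bracket preservation gives `(F ∘ c)' = [F c, F Z]`; undoing the
  -- conjugation by `exp (s • F Z)` leaves a constant.
  set v : ℝ → B := fun s => exp (s • F Z) * F (c s) * exp (-(s • F Z)) with hv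
  have hvd : ∀ s, HasDerivAt v 0 s := by
    intro s
    have h1 : HasDerivAt (fun s => F (c s)) (F (c s) * F Z - F Z * F (c s)) s := by
      rw [← hF _ (hcL s) _ hZ]
      exact F.hasFDerivAt.comp_hasDerivAt s (hcd s)
    have h := ((hasDerivAt_exp_smul_const (𝕂 := ℝ) (F Z) s).mul h1).mul
      (hasDerivAt_exp_neg_smul (F Z) s)
    refine h.congr_deriv ?_
    simp only [Pi.mul_apply]
    noncomm_ring
  have h := is_const_of_deriv_eq_zero (fun s => (hvd s).differentiableAt)
    (fun s => (hvd s).deriv) s 0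
  have h0 : v 0 = F W := by simp [hv, hc]
  rw [h0] at h
  have e : exp (-(s • F Z)) * exp (s • F Z) = 1 := by
    simpa using exp_mul_exp_neg (-(s • F Z))
  change F (c s) = _
  rw [← h, hv]
  simp only [mul_assoc, e, mul_one]
  rw [← mul_assoc, e, one_mul]

/-- The curve `exp ∘ Z` solves `u' = u * Y`, and `exp ∘ F ∘ Z` is shown to solve `u' = u * F Y`. The
interval `(-1, 2)` contains `[0, 1]` in its interior, so two-sided derivatives exist at both ends.
-/
theorem exp_map_eq_mul_of_curve (hLcl : IsClosed (L : Set A))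
    (hLc : ∀ X ∈ L, ∀ Y ∈ L, exp (-X) * Y * exp X ∈ L)
    (hF : ∀ X ∈ L, ∀ Y ∈ L, F (X * Y - Y * X) = F X * F Y - F Y * F X) {Z : ℝ → A} {X Y : A}
    (hZL : ∀ t ∈ Ioo (-1 : ℝ) 2, Z t ∈ L) (hZd : ∀ t ∈ Ioo (-1 : ℝ) 2, DifferentiableAt ℝ Z t)
    (hZe : ∀ t ∈ Ioo (-1 : ℝ) 2, exp (Z t) = X * exp (t • Y)) :
    exp (F (Z 1)) = exp (F (Z 0)) * exp (F Y) := by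
  let _ : NormedAlgebra ℚ A := NormedAlgebra.restrictScalars ℚ ℝ A
  have hexp := continuous_exp (A := A)
  set v : ℝ → B := fun t => exp (F (Z t)) * exp (-(t • F Y)) with hv
  have hvd : ∀ t ∈ Ioo (-1 : ℝ) 2, HasDerivAt v 0 t := by
    intro t ht
    have hnhds : Ioo (-1 : ℝ) 2 ∈ 𝓝 t := isOpen_Ioo.mem_nhds ht
    obtain ⟨W, hW⟩ : ∃ W, HasDerivAt Z W t := ⟨_, (hZd t ht).hasDerivAt⟩
    have hWL : W ∈ L := by
      refine hLcl.mem_of_tendsto (hasDerivAt_iff_tendsto_slope.1 hW) ?_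
      filter_upwards [mem_nhdsWithin_of_mem_nhds hnhds] with u hu
      rw [slope_def_module]
      exact L.smul_mem _ (L.sub_mem (hZL u hu) (hZL t ht))
    -- Compare two derivatives of `exp ∘ Z` and cancel the unit `exp (Z t)`.
    have hI : ∫ s in (0 : ℝ)..1, exp (-(s • Z t)) * W * exp (s • Z t) = Y := by
      have h1 := hasDerivAt_exp_comp hW
      have h2 : HasDerivAt (fun s => exp (Z s)) (exp (Z t) * Y) t := by
        rw [hZe t ht, mul_assoc]
        refine HasDerivAt.congr_of_eventuallyEq
          ((hasDerivAt_exp_smul_const (𝕂 := ℝ) Y t).const_mul X) ?_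
        filter_upwards [hnhds] with u hu using hZe u hu
      exact (expUnit (Z t)).isUnit.mul_left_cancel (h1.unique h2)
    have hI' : ∫ s in (0 : ℝ)..1, exp (-(s • F (Z t))) * F W * exp (s • F (Z t)) = F Y := by
      rw [← hI, ← F.intervalIntegral_comp_comm (Continuous.intervalIntegrable (by fun_prop) _ _)]
      exact intervalIntegral.integral_congr fun s _ =>
        (map_exp_conj hLc hF (hZL t ht) hWL s).symm
    have h1 : HasDerivAt (fun s => F (Z s)) (F W) t := F.hasFDerivAt.comp_hasDerivAt t hW
    have h := (hasDerivAt_exp_comp h1).mul (hasDerivAt_exp_neg_smul (F Y) t)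
    rw [hI'] at h
    refine h.congr_deriv ?_
    noncomm_ring
  have h := constant_of_has_deriv_right_zero (f := v) (a := 0) (b := 1)
    (fun t ht => (hvd t ⟨by linarith [ht.1], by linarith [ht.2]⟩).continuousAt.continuousWithinAt)
    (fun t ht => (hvd t ⟨by linarith [ht.1], by linarith [ht.2]⟩).hasDerivWithinAt) 1 (by simp)
  simp only [hv, one_smul, zero_smul, neg_zero, exp_zero, mul_one] at h
  have e : exp (-(F Y)) * exp (F Y) = 1 := by simpa using exp_mul_exp_neg (-(F Y))
  rw [← h, mul_assoc, e, mul_one]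

end ExpDerivative

/-! ### Logarithm, closed subgroup theorem and local path connectedness -/

section ClosedSubgroup

variable {A : Type*} [NormedRing A] [NormedAlgebra ℝ A] [CompleteSpace A]

theorem contDiff_exp : ContDiff ℝ 1 (exp : A → A) :=
  contDiff_iff_contDiffAt.2 fun X => (exp_analytic (𝕂 := ℝ) X).contDiffAt

theorem hasStrictFDerivAt_exp :
    HasStrictFDerivAt (exp : A → A) ((ContinuousLinearEquiv.refl ℝ A : A ≃L[ℝ] A) : A →L[ℝ] A) 0 :=
  hasStrictFDerivAt_exp_zero

theorem expUnit_zero : expUnit (0 : A) = 1 := by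
  ext
  simp [expUnit]

theorem expUnit_natCast_smul (n : ℕ) (X : A) : expUnit ((n : ℝ) • X) = expUnit X ^ n := by
  let _ : NormedAlgebra ℚ A := NormedAlgebra.restrictScalars ℚ ℝ A
  ext
  rw [Units.val_pow_eq_pow_val]
  change exp _ = exp X ^ n
  rw [← exp_nsmul, Nat.cast_smul_eq_nsmul]

theorem expUnit_neg (X : A) : expUnit (-X) = (expUnit X)⁻¹ := by
  ext
  rfl

theorem expUnit_intCast_smul (n : ℤ) (X : A) : expUnit ((n : ℝ) • X) = expUnit X ^ n := by
  obtain ⟨m, rfl | rfl⟩ := n.eq_nat_or_neg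
  · simp [expUnit_natCast_smul]
  · simp [expUnit_natCast_smul, expUnit_neg]

/-- A local inverse of the exponential map. -/
theorem exists_log : ∃ log : A → A, log 1 = 0 ∧ ContinuousAt log 1 ∧
    (∀ᶠ X in 𝓝 0, log (exp X) = X) ∧
    ∀ᶠ y in 𝓝 1, exp (log y) = y ∧ DifferentiableAt ℝ log y := by
  have hs := hasStrictFDerivAt_exp (A := A)
  have hd : ContDiffAt ℝ 1 (exp : A → A) 0 := contDiff_exp.contDiffAt
  have h := hd.to_localInverse hs.hasFDerivAt one_ne_zero
  have hd' := h.eventually (by simp)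
  have hr := hs.eventually_right_inverse
  have hl := hs.eventually_left_inverse
  have h0 := hs.localInverse_apply_image
  have hc := h.continuousAt
  rw [exp_zero] at hd' hr h0 hc
  refine ⟨_, h0, hc, hl, ?_⟩
  filter_upwards [hr, hd'] with y hy hy'
  exact ⟨hy, hy'.differentiableAt one_ne_zero⟩

variable {G : Subgroup Aˣ} {L : Submodule ℝ A}

theorem expUnit_mem (hL : ∀ X, X ∈ L ↔ ∀ t : ℝ, expUnit (t • X) ∈ G) {X : A} (hX : X ∈ L) :
    expUnit X ∈ G := by
  simpa using (hL X).1 hX 1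

/-- Conjugation by `exp (-X)` carries the one-parameter group of `Y` to another one inside `G`. -/
theorem exp_conj_mem (hL : ∀ X, X ∈ L ↔ ∀ t : ℝ, expUnit (t • X) ∈ G) {X Y : A} (hX : X ∈ L)
    (hY : Y ∈ L) : exp (-X) * Y * exp X ∈ L := by
  let _ : NormedAlgebra ℚ A := NormedAlgebra.restrictScalars ℚ ℝ A
  refine (hL _).2 fun t => ?_
  have e : expUnit (t • (exp (-X) * Y * exp X)) =
      (expUnit X)⁻¹ * expUnit (t • Y) * expUnit X := by
    ext
    rw [← smul_mul_assoc, ← mul_smul_comm]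
    exact exp_units_conj' (expUnit X) (t • Y)
  rw [e]
  exact mul_mem (mul_mem (inv_mem (expUnit_mem hL hX)) ((hL Y).1 hY t)) (expUnit_mem hL hX)

/-- The exponential map into a subgroup. -/
noncomputable def subgroupExp (hL : ∀ X, X ∈ L ↔ ∀ t : ℝ, expUnit (t • X) ∈ G) (X : L) : G :=
  ⟨expUnit (X : A), expUnit_mem hL X.2⟩

theorem continuous_subgroupExp (hL : ∀ X, X ∈ L ↔ ∀ t : ℝ, expUnit (t • X) ∈ G) :
    Continuous (subgroupExp hL) :=
  (continuous_expUnit.comp continuous_subtype_val).subtype_mk _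

theorem subgroupExp_zero (hL : ∀ X, X ∈ L ↔ ∀ t : ℝ, expUnit (t • X) ∈ G) :
    subgroupExp hL 0 = 1 :=
  Subtype.ext expUnit_zero

variable [FiniteDimensional ℝ A]

/-- Small nonzero vectors in a complement of the Lie algebra do not exponentiate into `G`. -/
theorem eventually_eq_zero_of_expUnit_mem (hcl : IsClosed (G : Set Aˣ))
    (hL : ∀ X, X ∈ L ↔ ∀ t : ℝ, expUnit (t • X) ∈ G) {N : Submodule ℝ A} (hN : Disjoint L N) :
    ∀ᶠ y : N in 𝓝 0, expUnit (y : A) ∈ G → y = 0 := by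
  by_contra hfr
  have hfr' : ∃ᶠ y : N in 𝓝 0, expUnit (y : A) ∈ G ∧ y ≠ 0 :=
    (not_eventually.1 hfr).mono fun y hy => Classical.not_imp.1 hy
  have hne : (𝓝 (0 : N) ⊓ 𝓟 {y : N | expUnit (y : A) ∈ G ∧ y ≠ 0}).NeBot :=
    frequently_mem_iff_neBot.1 hfr'
  -- An ultrafilter replaces a subsequence: along it the directions `y / ‖y‖` converge on the
  -- compact unit sphere of `N`, to a vector `u` that will be shown to lie in `L` as well.
  let 𝒰 := Ultrafilter.of (𝓝 (0 : N) ⊓ 𝓟 {y : N | expUnit (y : A) ∈ G ∧ y ≠ 0})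
  have h𝒰 : (𝒰 : Filter N) ≤ 𝓝 0 ⊓ 𝓟 {y : N | expUnit (y : A) ∈ G ∧ y ≠ 0} :=
    Ultrafilter.of_le _
  have h0 : Tendsto (fun y : N => y) 𝒰 (𝓝 0) := h𝒰.trans inf_le_left
  have hmem : ∀ᶠ y : N in 𝒰, expUnit (y : A) ∈ G ∧ y ≠ 0 :=
    le_principal_iff.1 (h𝒰.trans inf_le_right)
  have hproper : ProperSpace N := FiniteDimensional.proper ℝ N
  obtain ⟨u, hu, hlim⟩ := (isCompact_sphere (0 : N) 1).ultrafilter_le_nhds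
    (𝒰.map fun y => ‖y‖⁻¹ • y) (by
      rw [le_principal_iff, Ultrafilter.mem_coe, Ultrafilter.mem_map]
      filter_upwards [hmem] with y hy
      simp [norm_smul, hy.2])
  have hlim' : Tendsto (fun y : N => ‖y‖⁻¹ • y) 𝒰 (𝓝 u) := hlim
  have huL : (u : A) ∈ L := by
    refine (hL _).2 fun t => ?_
    have hn : Tendsto (fun y : N => ‖y‖) 𝒰 (𝓝 0) := by simpa using h0.norm
    -- Integer multiples of `y` approximate `t • u`, and their exponentials are powers of `expUnit y
    -- ∈ G`; closedness of `G` then gives `expUnit (t • u) ∈ G`.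
    have hk : Tendsto (fun y : N => (⌊t / ‖y‖⌋ : ℝ) * ‖y‖) 𝒰 (𝓝 t) := by
      have hl : Tendsto (fun y : N => t - ‖y‖) 𝒰 (𝓝 t) := by simpa using hn.const_sub t
      refine tendsto_of_tendsto_of_tendsto_of_le_of_le' hl tendsto_const_nhds ?_ ?_
      · filter_upwards [hmem] with y hy
        have hy0 : 0 < ‖y‖ := norm_pos_iff.2 hy.2
        have h := (Int.sub_one_lt_floor (t / ‖y‖)).le
        calc t - ‖y‖ = (t / ‖y‖ - 1) * ‖y‖ := by field_simp
          _ ≤ _ := by gcongr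
      · filter_upwards [hmem] with y hy
        have hy0 : 0 < ‖y‖ := norm_pos_iff.2 hy.2
        exact (le_div_iff₀ hy0).1 (Int.floor_le (t / ‖y‖))
    have hz : Tendsto (fun y : N => expUnit ((⌊t / ‖y‖⌋ : ℝ) • (y : A))) 𝒰
        (𝓝 (expUnit (t • (u : A)))) := by
      refine (continuous_expUnit.tendsto _).comp ?_
      have h := hk.smul ((continuous_subtype_val.tendsto u).comp hlim')
      refine h.congr' ?_
      filter_upwards [hmem] with y hy
      have hy0 : ‖y‖ ≠ 0 := norm_ne_zero_iff.2 hy.2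
      simp only [Function.comp_apply, Submodule.coe_smul, smul_smul, mul_assoc]
      rw [mul_inv_cancel₀ hy0, mul_one]
    refine hcl.mem_of_tendsto hz ?_
    filter_upwards [hmem] with y hy
    rw [expUnit_intCast_smul]
    exact zpow_mem hy.1 _
  have hu0 : (u : A) = 0 := (Submodule.disjoint_def.1 hN) _ huL u.2
  rw [mem_sphere_zero_iff_norm] at hu
  simp [ZeroMemClass.coe_eq_zero.1 hu0] at hu

/-- The closed subgroup theorem: elements of `G` near `1` are exponentials of small vectors of the
Lie algebra. -/
theorem eventually_exists_expUnit_eq (hcl : IsClosed (G : Set Aˣ))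
    (hL : ∀ X, X ∈ L ↔ ∀ t : ℝ, expUnit (t • X) ∈ G) {P : A → Prop} (hP : ∀ᶠ X in 𝓝 0, P X) :
    ∀ᶠ g in 𝓝 (1 : Aˣ), g ∈ G → ∃ X ∈ L, P X ∧ expUnit X = g := by
  obtain ⟨N, hN⟩ := L.exists_isCompl
  have hcL : CompleteSpace L := FiniteDimensional.complete ℝ L
  have hcN : CompleteSpace N := FiniteDimensional.complete ℝ N
  have h1 : HasStrictFDerivAt (fun p : L × N => exp (p.1 : A))
      (L.subtypeL.comp (ContinuousLinearMap.fst ℝ L N)) 0 :=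
    (hasStrictFDerivAt_exp (A := A)).comp (0 : L × N)
      (L.subtypeL.comp (ContinuousLinearMap.fst ℝ L N)).hasStrictFDerivAt
  have h2 : HasStrictFDerivAt (fun p : L × N => exp (p.2 : A))
      (N.subtypeL.comp (ContinuousLinearMap.snd ℝ L N)) 0 :=
    (hasStrictFDerivAt_exp (A := A)).comp (0 : L × N)
      (N.subtypeL.comp (ContinuousLinearMap.snd ℝ L N)).hasStrictFDerivAt
  -- The derivative at `0` of `(x, y) ↦ exp x * exp y` is `(x, y) ↦ x + y`, onto because `L ⊔ N =
  -- ⊤`; so every element near `1` is such a product with small factors.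
  have hΦ := (h1.mul' h2).map_nhds_eq_of_surj (by
    rw [LinearMap.range_eq_top]
    intro a
    obtain ⟨x, hx, y, hy, rfl⟩ := Submodule.mem_sup.1
      (show a ∈ L ⊔ N by rw [hN.sup_eq_top]; trivial)
    refine ⟨(⟨x, hx⟩, ⟨y, hy⟩), ?_⟩
    simp [add_comm])
  have e1 : Tendsto (fun p : L × N => (p.1 : A)) (𝓝 0) (𝓝 0) :=
    (continuous_subtype_val.comp continuous_fst).tendsto' _ _ rfl
  have e2 : Tendsto (fun p : L × N => p.2) (𝓝 0) (𝓝 0) := continuous_snd.tendsto' _ _ rfl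
  have hev := (e1.eventually hP).and
    (e2.eventually (eventually_eq_zero_of_expUnit_mem hcl hL hN.disjoint))
  have him := image_mem_map (m := fun p : L × N => exp (p.1 : A) * exp (p.2 : A)) hev
  have hmap : map (fun p : L × N => exp (p.1 : A) * exp (p.2 : A)) (𝓝 0) = 𝓝 1 := by
    refine Eq.trans hΦ ?_
    simp
  rw [hmap] at him
  have hval : Tendsto (fun g : Aˣ => (g : A)) (𝓝 1) (𝓝 1) :=
    Units.continuous_val.tendsto' _ _ rfl
  filter_upwards [hval.eventually him] with g hg hgG
  obtain ⟨⟨x, y⟩, ⟨hx, hy⟩, hxy⟩ := hg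
  have hg' : g = expUnit (x : A) * expUnit (y : A) := Units.ext hxy.symm
  have hyG : expUnit (y : A) ∈ G := by
    have : expUnit (y : A) = (expUnit (x : A))⁻¹ * g := by rw [hg', inv_mul_cancel_left]
    rw [this]
    exact mul_mem (inv_mem (expUnit_mem hL x.2)) hgG
  refine ⟨x, x.2, hx, ?_⟩
  have hy0 : y = 0 := hy hyG
  rw [hg', hy0, ZeroMemClass.coe_zero, expUnit_zero, mul_one]

theorem image_subgroupExp_mem_nhds (hcl : IsClosed (G : Set Aˣ))
    (hL : ∀ X, X ∈ L ↔ ∀ t : ℝ, expUnit (t • X) ∈ G) {r : ℝ} (hr : 0 < r) :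
    subgroupExp hL '' Metric.ball 0 r ∈ 𝓝 1 := by
  have hval : Tendsto (fun g : G => (g : Aˣ)) (𝓝 1) (𝓝 1) :=
    continuous_subtype_val.tendsto' _ _ rfl
  filter_upwards [hval.eventually
    (eventually_exists_expUnit_eq hcl hL (Metric.ball_mem_nhds (0 : A) hr))] with g hg
  obtain ⟨X, hX, hXr, e⟩ := hg g.2
  exact ⟨⟨X, hX⟩, by simpa using hXr, Subtype.ext e⟩

/-- Translated exponential images of balls in `L` are path connected, balls being convex, and form
neighbourhood bases. The lifting criterion for coverings needs this. -/
theorem locallyPathConnectedSpace (hcl : IsClosed (G : Set Aˣ))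
    (hL : ∀ X, X ∈ L ↔ ∀ t : ℝ, expUnit (t • X) ∈ G) : LocallyPathConnectedSpace G := by
  refine LocallyPathConnectedSpace.of_bases (p := fun _ r => 0 < r)
    (s := fun g (r : ℝ) => (fun X => g * subgroupExp hL X) '' Metric.ball 0 r) ?_ ?_
  · intro g
    refine ⟨fun t => ⟨fun ht => ?_, ?_⟩⟩
    · have hc : Continuous fun X => g * subgroupExp hL X :=
        continuous_const.mul (continuous_subgroupExp hL)
      have h := hc.tendsto' 0 g (by rw [subgroupExp_zero, mul_one]) ht
      obtain ⟨r, hr, h⟩ := Metric.mem_nhds_iff.1 h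
      exact ⟨r, hr, image_subset_iff.2 h⟩
    · rintro ⟨r, hr, h⟩
      refine mem_of_superset ?_ h
      have ht : Tendsto (fun x => g⁻¹ * x) (𝓝 g) (𝓝 1) := by
        simpa using (continuous_const_mul g⁻¹).tendsto g
      filter_upwards [ht (image_subgroupExp_mem_nhds hcl hL hr)] with x hx
      obtain ⟨X, hX, e⟩ := hx
      exact ⟨X, hX, by simp [e]⟩
  · intro g r hr
    exact ((convex_ball _ _).isPathConnected ⟨0, Metric.mem_ball_self hr⟩).image
      (continuous_const.mul (continuous_subgroupExp hL))

end ClosedSubgroup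

/-! ### From the Lie algebra map to the group homomorphism -/

section LieSecond

variable {A B : Type*} [NormedRing A] [NormedAlgebra ℝ A] [CompleteSpace A]
  [FiniteDimensional ℝ A] [NormedRing B] [NormedAlgebra ℝ B] [CompleteSpace B]
  {G : Subgroup Aˣ} {L : Submodule ℝ A} {F : A →L[ℝ] B}

/-- In exponential coordinates, a map that preserves brackets is a local homomorphism. -/
theorem exists_eventually_map_log_mul (hcl : IsClosed (G : Set Aˣ))
    (hL : ∀ X, X ∈ L ↔ ∀ t : ℝ, expUnit (t • X) ∈ G)
    (hF : ∀ X ∈ L, ∀ Y ∈ L, F (X * Y - Y * X) = F X * F Y - F Y * F X) :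
    ∃ log : A → A, log 1 = 0 ∧ ContinuousAt log 1 ∧ (∀ᶠ X in 𝓝 0, log (exp X) = X) ∧
      ∃ U ∈ 𝓝 (1 : G), ∀ x ∈ U, ∀ y ∈ U,
        exp (F (log ((x * y : G) : Aˣ))) = exp (F (log (x : Aˣ))) * exp (F (log (y : Aˣ))) := by
  obtain ⟨log, hlog1, hlogc, hle, hel⟩ := exists_log (A := A)
  refine ⟨log, hlog1, hlogc, hle, ?_⟩
  have hval : Tendsto (fun g : Aˣ => (g : A)) (𝓝 1) (𝓝 1) :=
    Units.continuous_val.tendsto' _ _ rfl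
  have hQ : ∀ᶠ g : Aˣ in 𝓝 1, (exp (log g) = g ∧ DifferentiableAt ℝ log g) ∧
      (g ∈ G → log g ∈ L) := by
    filter_upwards [hval.eventually hel, eventually_exists_expUnit_eq hcl hL hle] with g hg hg'
    refine ⟨hg, fun hgG => ?_⟩
    obtain ⟨X, hX, hXl, rfl⟩ := hg' hgG
    change log (exp X) ∈ L
    rwa [hXl]
  have hc : Tendsto (fun p : A × A => expUnit p.1 * expUnit p.2) (𝓝 0 ×ˢ 𝓝 0) (𝓝 1) := by
    have h : Continuous fun p : A × A => expUnit p.1 * expUnit p.2 :=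
      (continuous_expUnit.comp continuous_fst).mul (continuous_expUnit.comp continuous_snd)
    have := h.tendsto (0, 0)
    rwa [nhds_prod_eq, expUnit_zero, mul_one] at this
  obtain ⟨s, hs, hsQ⟩ := (eventually_prod_self_iff (r := fun X Y : A =>
    (exp (log ↑(expUnit X * expUnit Y)) = ↑(expUnit X * expUnit Y) ∧
      DifferentiableAt ℝ log ↑(expUnit X * expUnit Y)) ∧
      (expUnit X * expUnit Y ∈ G → log ↑(expUnit X * expUnit Y) ∈ L))).1 (hc.eventually hQ)
  obtain ⟨ε, hε, hεs⟩ := Metric.mem_nhds_iff.1 hs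
  have hsub : Tendsto (fun g : G => (g : Aˣ)) (𝓝 1) (𝓝 1) :=
    continuous_subtype_val.tendsto' _ _ rfl
  have hlog0 : Tendsto log (𝓝 1) (𝓝 0) := by simpa [ContinuousAt, hlog1] using hlogc
  -- Radius `ε / 2` keeps `t • log y` within `ε` for all `|t| ≤ 2`, hence along the whole curve on
  -- `(-1, 2)`.
  have hU := (hsub.eventually hQ).and (((hlog0.comp hval).comp hsub).eventually
    (Metric.ball_mem_nhds (0 : A) (half_pos hε)))
  refine ⟨_, hU, fun x hx y hy => ?_⟩
  obtain ⟨⟨⟨hxe, -⟩, hxL⟩, hxε⟩ := hx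
  obtain ⟨⟨⟨hye, -⟩, hyL⟩, hyε⟩ := hy
  replace hxL := hxL x.2
  replace hyL := hyL y.2
  have hxε' : ‖log (x : Aˣ)‖ < ε / 2 := by simpa using hxε
  have hyε' : ‖log (y : Aˣ)‖ < ε / 2 := by simpa using hyε
  have hcurve : ∀ t ∈ Ioo (-1 : ℝ) 2,
      (exp (log (exp (log (x : Aˣ)) * exp (t • log (y : Aˣ)))) =
        exp (log (x : Aˣ)) * exp (t • log (y : Aˣ)) ∧
      DifferentiableAt ℝ log (exp (log (x : Aˣ)) * exp (t • log (y : Aˣ)))) ∧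
      log (exp (log (x : Aˣ)) * exp (t • log (y : Aˣ))) ∈ L := by
    intro t ht
    have h := hsQ (log (x : Aˣ)) (hεs (by simpa using hxε'.trans (half_lt_self hε)))
      (t • log (y : Aˣ)) (hεs (by
        have h2 : |t| ≤ 2 := abs_le.2 ⟨by linarith [ht.1], ht.2.le⟩
        rw [mem_ball_zero_iff, norm_smul, Real.norm_eq_abs]
        calc |t| * ‖log (y : Aˣ)‖ ≤ 2 * ‖log (y : Aˣ)‖ := by gcongr
          _ < ε := by linarith))
    exact ⟨h.1, h.2 (mul_mem (expUnit_mem hL hxL) ((hL _).1 hyL t))⟩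
  have hmain := exp_map_eq_mul_of_curve (F := F)
    (Z := fun t => log (exp (log (x : Aˣ)) * exp (t • log (y : Aˣ))))
    L.closed_of_finiteDimensional (fun X hX Y hY => exp_conj_mem hL hX hY) hF
    (fun t ht => (hcurve t ht).2)
    (fun t ht => (hcurve t ht).1.2.comp t
      ((hasDerivAt_exp_smul_const (𝕂 := ℝ) _ t).differentiableAt.const_mul _))
    (fun t ht => (hcurve t ht).1.1)
  simpa [hxe, hye] using hmain

/-- The extension agrees with `exp ∘ F ∘ log` only near `1`. This yields continuity at `1`, thus
everywhere, and the formula for small vectors; a general `X` is reached by taking the `n`-th power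
at `X / n`. -/
theorem exists_monoidHom_expUnit (hcl : IsClosed (G : Set Aˣ))
    (hL : ∀ X, X ∈ L ↔ ∀ t : ℝ, expUnit (t • X) ∈ G) (hsc : SimplyConnectedSpace G)
    (hF : ∀ X ∈ L, ∀ Y ∈ L, F (X * Y - Y * X) = F X * F Y - F Y * F X) :
    ∃ f : G →* Bˣ, Continuous f ∧ ∀ X : L, f (subgroupExp hL X) = expUnit (F X) := by
  have hlpc := locallyPathConnectedSpace hcl hL
  obtain ⟨log, hlog1, hlogc, hle, U, hU, hmul⟩ := exists_eventually_map_log_mul hcl hL hF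
  obtain ⟨f, hf⟩ := exists_monoidHom_eventuallyEq (H := Bˣ)
    (φ := fun g : G => expUnit (F (log (g : Aˣ)))) hU
    (fun x hx y hy => Units.ext (hmul x hx y hy))
  refine ⟨f, continuous_of_continuousAt_one f ?_, fun X => ?_⟩
  · refine ContinuousAt.congr ?_ (hf.mono fun _ => Eq.symm)
    refine continuous_expUnit.continuousAt.comp (F.continuous.continuousAt.comp ?_)
    refine ContinuousAt.comp (g := log) (f := fun g : G => ((g : Aˣ) : A)) hlogc ?_
    exact (Units.continuous_val.comp continuous_subtype_val).continuousAt
  · have hsmall : ∀ᶠ Y : L in 𝓝 0, f (subgroupExp hL Y) = expUnit (F Y) := by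
      have h1 : Tendsto (subgroupExp hL) (𝓝 0) (𝓝 1) :=
        (continuous_subgroupExp hL).tendsto' _ _ (subgroupExp_zero hL)
      have h2 : Tendsto (fun Y : L => (Y : A)) (𝓝 0) (𝓝 0) :=
        continuous_subtype_val.tendsto' _ _ rfl
      filter_upwards [h1.eventually hf, h2.eventually hle] with Y hY hY'
      rw [hY]
      change expUnit (F (log (exp (Y : A)))) = _
      rw [hY']
    have hlim : Tendsto (fun n : ℕ => ((n : ℝ)⁻¹) • X) atTop (𝓝 0) := by
      simpa using (tendsto_inv_atTop_nhds_zero_nat (𝕜 := ℝ)).smul_const X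
    obtain ⟨n, hn, hn0⟩ := ((hlim.eventually hsmall).and (eventually_ne_atTop 0)).exists
    have hn' : (n : ℝ) ≠ 0 := Nat.cast_ne_zero.2 hn0
    have e : subgroupExp hL X = subgroupExp hL ((n : ℝ)⁻¹ • X) ^ n := by
      refine Subtype.ext ?_
      change expUnit (X : A) = expUnit ((n : ℝ)⁻¹ • (X : A)) ^ n
      rw [← expUnit_natCast_smul, smul_inv_smul₀ hn']
    rw [e, map_pow, hn, ← expUnit_natCast_smul, ← map_smul, ← Submodule.coe_smul,
      smul_inv_smul₀ hn']

/-- Such a `K` contains a neighbourhood of `1`, so it is open, therefore closed, and equals the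
connected group `G`. -/
theorem mem_of_subgroupExp_mem (hcl : IsClosed (G : Set Aˣ))
    (hL : ∀ X, X ∈ L ↔ ∀ t : ℝ, expUnit (t • X) ∈ G) (hcon : ConnectedSpace G) {K : Subgroup G}
    (hK : ∀ X : L, subgroupExp hL X ∈ K) (g : G) : g ∈ K := by
  have h1 : (K : Set G) ∈ 𝓝 1 := by
    refine mem_of_superset (image_subgroupExp_mem_nhds hcl hL one_pos) ?_
    rintro _ ⟨X, -, rfl⟩
    exact hK X
  have ho := K.isOpen_of_mem_nhds h1
  have h := IsClopen.eq_univ ⟨K.isClosed_of_isOpen ho, ho⟩ ⟨1, K.one_mem⟩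
  exact h.ge (mem_univ g)

end LieSecond

/-! ### Application to matrix groups, and smoothness -/

section MatrixGroups

open scoped ContDiff

/-- The Frobenius norm is the one used by `IsSmooth`; it also makes the matrices a complete normed
algebra, where `exp` is analytic. -/
theorem contDiff_matrix_exp_comp {d : ℕ} {E : Type*} [NormedAddCommGroup E] [NormedSpace ℝ E]
    [FiniteDimensional ℝ E] (c : Matrix (Fin d) (Fin d) ℝ)
    (F : E →ₗ[ℝ] Matrix (Fin d) (Fin d) ℝ) :
    letI := Matrix.frobeniusNormedAddCommGroup (m := Fin d) (n := Fin d) (α := ℝ)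
    letI := Matrix.frobeniusNormedSpace (m := Fin d) (n := Fin d) (R := ℝ) (α := ℝ)
    ContDiff ℝ ∞ fun X => c * exp (F X) := by
  let _ := Matrix.frobeniusNormedRing (m := Fin d) (α := ℝ)
  let _ := Matrix.frobeniusNormedAlgebra (m := Fin d) (R := ℝ) (α := ℝ)
  have _ : CompleteSpace (Matrix (Fin d) (Fin d) ℝ) := FiniteDimensional.complete ℝ _
  have h1 : ContDiff ℝ ∞ (exp : Matrix (Fin d) (Fin d) ℝ → _) :=
    contDiff_iff_contDiffAt.2 fun X => (exp_analytic (𝕂 := ℝ) X).contDiffAt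
  have h2 : ContDiff ℝ ∞ F := (LinearMap.toContinuousLinearMap F).contDiff
  exact contDiff_const.mul (h1.comp h2)

theorem exists_monoidHom_lieExp {d₁ d₂ : ℕ} (G₁ : MatrixLieGroup d₁) (G₂ : MatrixLieGroup d₂)
    (hG₁ : SimplyConnectedSpace G₁)
    (F : lieAlgebra G₁ →ₗ⁅ℝ⁆ lieAlgebra G₂) :
    ∃ f : G₁ →* G₂, Continuous f ∧ IsDifferential f F := by
  let _ := Matrix.linftyOpNormedRing (n := Fin d₁) (α := ℝ)
  let _ := Matrix.linftyOpNormedAlgebra (n := Fin d₁) (R := ℝ) (α := ℝ)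
  let _ := Matrix.linftyOpNormedRing (n := Fin d₂) (α := ℝ)
  let _ := Matrix.linftyOpNormedAlgebra (n := Fin d₂) (R := ℝ) (α := ℝ)
  have _ := completeSpace (d := d₁)
  have _ := completeSpace (d := d₂)
  let L := (lieAlgebra G₁).toSubmodule
  have hL : ∀ X, X ∈ L ↔ ∀ t : ℝ, expUnit (t • X) ∈ G₁.toSubgroup := fun X => Iff.rfl
  -- An arbitrary linear extension to all matrices is enough: brackets need to be preserved only on
  -- `L`.
  obtain ⟨F', hF'⟩ := LinearMap.exists_extend (p := L)
    ((lieAlgebra G₂).toSubmodule.subtype ∘ₗ (F : lieAlgebra G₁ →ₗ[ℝ] lieAlgebra G₂))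
  have hF'' : ∀ X : lieAlgebra G₁, F' X = F X := fun X => LinearMap.congr_fun hF' X
  have hbr : ∀ X ∈ L, ∀ Y ∈ L, F' (X * Y - Y * X) = F' X * F' Y - F' Y * F' X := by
    intro X hX Y hY
    have h := congrArg Subtype.val (F.map_lie ⟨X, hX⟩ ⟨Y, hY⟩)
    rw [← hF''] at h
    rw [hF'' ⟨X, hX⟩, hF'' ⟨Y, hY⟩]
    exact h
  have hcon : ConnectedSpace G₁ := inferInstance
  obtain ⟨f, hfc, hf⟩ := exists_monoidHom_expUnit (G := G₁.toSubgroup) (L := L)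
    (F := LinearMap.toContinuousLinearMap F') G₁.isClosed' hL hG₁ hbr
  have hf' : ∀ X : lieAlgebra G₁, f (subgroupExp hL X) = lieExp G₂ (F X) := fun X => by
    refine (hf X).trans ?_
    refine Units.ext ?_
    change exp (F' X) = exp _
    rw [hF'']
  -- So far `f` takes values in the full linear group; the preimage of `G₂` contains all
  -- exponentials, hence is everything.
  have hmem : ∀ g, f g ∈ G₂.toSubgroup := fun g =>
    mem_of_subgroupExp_mem (K := G₂.toSubgroup.comap f) G₁.isClosed' hL hcon (fun X => by
      rw [Subgroup.mem_comap, hf']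
      exact (lieExp G₂ (F X)).2) g
  exact ⟨f.codRestrict G₂.toSubgroup hmem, hfc.subtype_mk hmem,
    fun X => Subtype.ext (hf' X).symm⟩

theorem isSmooth_of_isDifferential {d₁ d₂ : ℕ} {G₁ : MatrixLieGroup d₁} {G₂ : MatrixLieGroup d₂}
    {f : G₁ →* G₂} {F : lieAlgebra G₁ →ₗ⁅ℝ⁆ lieAlgebra G₂} (hc : Continuous f)
    (hf : IsDifferential f F) : IsSmooth f := by
  refine ⟨hc, fun g => ?_⟩
  have e : ∀ X : lieAlgebra G₁,
      ((f (g * lieExp G₁ X) : GL (Fin d₂) ℝ) : Matrix (Fin d₂) (Fin d₂) ℝ) =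
        (f g : GL (Fin d₂) ℝ) * exp ((F X : Matrix (Fin d₂) (Fin d₂) ℝ)) := fun X => by
    rw [map_mul, ← hf X]
    rfl
  simp only [e]
  let _ := Matrix.frobeniusNormedAddCommGroup (m := Fin d₁) (n := Fin d₁) (α := ℝ)
  let _ := Matrix.frobeniusNormedSpace (m := Fin d₁) (n := Fin d₁) (R := ℝ) (α := ℝ)
  have _ : FiniteDimensional ℝ (lieAlgebra G₁) :=
    inferInstanceAs (FiniteDimensional ℝ (lieAlgebra G₁).toSubmodule)
  exact contDiff_matrix_exp_comp (E := lieAlgebra G₁) _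
    ((lieAlgebra G₂).toSubmodule.subtype ∘ₗ (F : lieAlgebra G₁ →ₗ[ℝ] lieAlgebra G₂))

end MatrixGroups

end MatrixLie

theorem mainTheorem8 {d₁ d₂ : ℕ} (G₁ : MatrixLie.MatrixLieGroup d₁)
    (G₂ : MatrixLie.MatrixLieGroup d₂) (hG₁ : SimplyConnectedSpace G₁)
    (F : MatrixLie.lieAlgebra G₁ →ₗ⁅ℝ⁆ MatrixLie.lieAlgebra G₂) :
    ∃ f : G₁ →* G₂, MatrixLie.IsSmooth f ∧ MatrixLie.IsDifferential f F := by
  obtain ⟨f, hc, hf⟩ := MatrixLie.exists_monoidHom_lieExp G₁ G₂ hG₁ F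
  exact ⟨f, MatrixLie.isSmooth_of_isDifferential hc hf, hf⟩
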